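/- For $n\ge 1$ let $H_n=\sum_{j=1}^n \frac1j$, let $\gamma=\lim_{n\to\infty}(H_n-\log n)$ be the Euler–Mascheroni constant, let $\Gamma$ be the gamma function, and let $G$ be the Barnes $G$-function, given by $$G(1+z)=(2\pi)^{z/2}\exp\left(-\frac{z+(1+\gamma)z^2}{2}\right)\prod_{k=1}^\infty\left(1+\frac zk\right)^k\exp\left(\frac{z^2}{2k}-z\right).$$ Then for every real $x>0$ the following series converges and $$\sum_{n=1}^\infty(-1)^n\,n\left(H_n-\log(n+x-1)-\gamma+\frac xn-\frac{3}{2n}\right)=\frac{\gamma}{4}-\frac{x-\log 2-1}{2}-2\log\left[\frac{G\left(\frac{x+1}{2}\right)}{G\left(\frac x2\right)}\right]+\log\Gamma\left(\frac x2\right),$$ where the sum is the limit of the partial sums $\sum_{n=1}^N$ as $N\to\infty$. -/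

import Mathlib

/-- The Barnes `G`-function on the real line, by its Weierstrass product
`G(1 + z) = (2π)^(z/2) exp(-(z + (1 + γ) z²) / 2) ∏_{k ≥ 1} (1 + z/k)^k exp(z²/(2k) - z)`
taken at `z = x - 1`; the factor with index `k : ℕ` below is the one for `k + 1`.
The product converges absolutely for every real `z`. -/
noncomputable def barnesG (x : ℝ) : ℝ :=
  (2 * Real.pi) ^ ((x - 1) / 2) *
    Real.exp (-((x - 1) + (1 + Real.eulerMascheroniConstant) * (x - 1) ^ 2) / 2) *
    ∏' k : ℕ, ((1 + (x - 1) / ((k : ℝ) + 1)) ^ (k + 1) *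
      Real.exp ((x - 1) ^ 2 / (2 * ((k : ℝ) + 1)) - (x - 1)))

open Filter Topology Finset

/-! Pair the terms `2m+1` and `2m+2`. Their logarithms carry weights `2m+1 = 2(m+1) - 1` and
`2(m+1)`, so each pair yields twice a difference of log factors of `G(x/2)` and `G((x+1)/2)`, plus
one leftover `log (x/2 + m)`. The leftovers sum to `log Γ(x/2)` by Euler's limit formula, and
Stirling with `H_n - log n - γ ~ 1/(2n)` settles the rest. The terms tend to `0`, so odd partial
sums share the limit. -/

/-- The logarithm of the factor of index `k` in the Weierstrass product of `G(1 + z)`. -/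
noncomputable def barnesLogFactor (z : ℝ) (k : ℕ) : ℝ :=
  ((k : ℝ) + 1) * Real.log (1 + z / ((k : ℝ) + 1)) + (z ^ 2 / (2 * ((k : ℝ) + 1)) - z)

lemma one_add_div_natCast_succ_pos {z : ℝ} (hz : -1 < z) (k : ℕ) :
    0 < 1 + z / ((k : ℝ) + 1) := by
  have hk : (0 : ℝ) < (k : ℝ) + 1 := by positivity
  have hk0 : (0 : ℝ) ≤ k := Nat.cast_nonneg k
  rw [show 1 + z / ((k : ℝ) + 1) = ((k : ℝ) + 1 + z) / ((k : ℝ) + 1) by field_simp]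
  exact div_pos (by linarith) hk

/-- The second-order Taylor remainder of `log (1 + u)` for small `u`. -/
lemma abs_log_one_add_sub_le {u : ℝ} (hu : |u| ≤ 1 / 2) :
    |Real.log (1 + u) - u + u ^ 2 / 2| ≤ 2 * |u| ^ 3 := by
  have h := Real.abs_log_sub_add_sum_range_le (x := -u) (by rw [abs_neg]; linarith) 2
  rw [abs_neg] at h
  simp only [sum_range_succ, sum_range_zero, sub_neg_eq_add] at h
  norm_num at h
  rw [show Real.log (1 + u) - u + u ^ 2 / 2 = -u + u ^ 2 / 2 + Real.log (1 + u) by ring]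
  refine h.trans ?_
  rw [div_le_iff₀ (by linarith)]
  nlinarith [pow_nonneg (abs_nonneg u) 3]

/-- The exponential factor cancels the Taylor terms of orders one and two, leaving `O(|z|^3 / k^2)`.
-/
lemma summable_barnesLogFactor (z : ℝ) : Summable (barnesLogFactor z) := by
  have hs : Summable fun k : ℕ => 2 * |z| ^ 3 * (1 / ((k : ℝ) + 1) ^ 2) := by
    have := (summable_nat_add_iff 1).2 (Real.summable_one_div_nat_pow.2 one_lt_two)
    simpa using this.mul_left (2 * |z| ^ 3)
  refine hs.of_norm_bounded_eventually_nat ?_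
  filter_upwards [eventually_ge_atTop ⌈2 * |z|⌉₊] with k hk
  have hkz : 2 * |z| ≤ k := Nat.ceil_le.1 hk
  have hk0 : (0 : ℝ) < (k : ℝ) + 1 := by positivity
  have hu : |z / ((k : ℝ) + 1)| ≤ 1 / 2 := by
    rw [abs_div, abs_of_pos hk0, div_le_iff₀ hk0]
    linarith
  have h := abs_log_one_add_sub_le hu
  have e : barnesLogFactor z k = ((k : ℝ) + 1) *
      (Real.log (1 + z / ((k : ℝ) + 1)) - z / ((k : ℝ) + 1) + (z / ((k : ℝ) + 1)) ^ 2 / 2) := by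
    unfold barnesLogFactor
    field_simp
    ring
  rw [Real.norm_eq_abs, e, abs_mul, abs_of_pos hk0]
  calc _ ≤ ((k : ℝ) + 1) * (2 * |z / ((k : ℝ) + 1)| ^ 3) := by gcongr
    _ = _ := by
      rw [abs_div, abs_of_pos hk0]
      field_simp

lemma barnesG_eq_exp {x : ℝ} (hx : 0 < x) :
    barnesG x = Real.exp ((x - 1) / 2 * Real.log (2 * Real.pi)
      - ((x - 1) + (1 + Real.eulerMascheroniConstant) * (x - 1) ^ 2) / 2
      + ∑' k, barnesLogFactor (x - 1) k) := by
  have hpos (k : ℕ) : 0 < 1 + (x - 1) / ((k : ℝ) + 1) :=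
    one_add_div_natCast_succ_pos (by linarith) k
  have hlog (k : ℕ) : Real.log ((1 + (x - 1) / ((k : ℝ) + 1)) ^ (k + 1) *
      Real.exp ((x - 1) ^ 2 / (2 * ((k : ℝ) + 1)) - (x - 1))) = barnesLogFactor (x - 1) k := by
    rw [Real.log_mul (pow_pos (hpos k) _).ne' (Real.exp_ne_zero _), Real.log_exp, Real.log_pow,
      barnesLogFactor]
    push_cast
    ring
  have hprod := Real.rexp_tsum_eq_tprod
    (f := fun k : ℕ => (1 + (x - 1) / ((k : ℝ) + 1)) ^ (k + 1) *
      Real.exp ((x - 1) ^ 2 / (2 * ((k : ℝ) + 1)) - (x - 1)))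
    (fun k => mul_pos (pow_pos (hpos k) _) (Real.exp_pos _))
    (by simpa only [hlog] using summable_barnesLogFactor (x - 1))
  simp only [hlog] at hprod
  rw [barnesG, ← hprod, Real.rpow_def_of_pos (by positivity), ← Real.exp_add, ← Real.exp_add]
  congr 1
  ring

lemma log_barnesG {x : ℝ} (hx : 0 < x) :
    Real.log (barnesG x) = (x - 1) / 2 * Real.log (2 * Real.pi)
      - ((x - 1) + (1 + Real.eulerMascheroniConstant) * (x - 1) ^ 2) / 2
      + ∑' k, barnesLogFactor (x - 1) k := by
  rw [barnesG_eq_exp hx, Real.log_exp]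

lemma barnesG_pos {x : ℝ} (hx : 0 < x) : 0 < barnesG x := by
  rw [barnesG_eq_exp hx]
  exact Real.exp_pos _

/-! ### Harmonic numbers: `H_n - log n - γ ~ 1/(2n)` -/

lemma harmonic_succ_cast (n : ℕ) :
    (harmonic (n + 1) : ℝ) = (harmonic n : ℝ) + 1 / ((n : ℝ) + 1) := by
  rw [harmonic_succ]
  push_cast
  rw [one_div]

lemma log_succ_sub_log_le {n : ℕ} (hn : 1 ≤ n) :
    Real.log ((n : ℝ) + 1) - Real.log n ≤ (1 / (n : ℝ) + 1 / ((n : ℝ) + 1)) / 2 := by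
  have hn0 : (0 : ℝ) < n := by exact_mod_cast hn
  have hy : 1 ≤ ((n : ℝ) + 1) / n := by
    rw [le_div_iff₀ hn0]
    linarith
  -- `t ≤ sinh t` at `t = log ((n+1)/n)` is exactly the trapezoid bound.
  have h := Real.self_le_sinh_iff.2 (Real.log_nonneg hy)
  rw [Real.sinh_log (by positivity), Real.log_div (by positivity) hn0.ne'] at h
  refine h.trans_eq ?_
  field_simp
  ring

lemma le_log_succ_sub_log {n : ℕ} (hn : 1 ≤ n) :
    2 / (2 * (n : ℝ) + 1) ≤ Real.log ((n : ℝ) + 1) - Real.log n := by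
  have hn0 : (0 : ℝ) < n := by exact_mod_cast hn
  have h := Real.le_log_one_add_of_nonneg (x := 1 / (n : ℝ)) (by positivity)
  rw [show 1 + 1 / (n : ℝ) = ((n : ℝ) + 1) / n by field_simp,
    Real.log_div (by positivity) hn0.ne'] at h
  refine le_of_eq_of_le ?_ h
  field_simp
  ring

/-- By the trapezoid bound, `H_n - log n - 1/(2n)` increases to `γ`. -/
lemma harmonic_sub_log_sub_eulerMascheroniConstant_le {n : ℕ} (hn : 1 ≤ n) :
    (harmonic n : ℝ) - Real.log n - Real.eulerMascheroniConstant ≤ 1 / (2 * (n : ℝ)) := by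
  have hmono : MonotoneOn (fun n : ℕ => (harmonic n : ℝ) - Real.log n - 1 / (2 * (n : ℝ)))
      (Set.Ici 1) := by
    refine monotoneOn_nat_Ici_of_le_succ fun m hm => ?_
    have hm0 : (0 : ℝ) < m := by exact_mod_cast hm
    have h := log_succ_sub_log_le hm
    have e : (1 / (m : ℝ) + 1 / ((m : ℝ) + 1)) / 2
        = 1 / ((m : ℝ) + 1) - 1 / (2 * ((m : ℝ) + 1)) + 1 / (2 * (m : ℝ)) := by
      field_simp
      ring
    rw [harmonic_succ_cast]
    push_cast
    linarith
  have hlim : Tendsto (fun n : ℕ => (harmonic n : ℝ) - Real.log n - 1 / (2 * (n : ℝ))) atTop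
      (𝓝 Real.eulerMascheroniConstant) := by
    have := Real.tendsto_harmonic_sub_log.sub
      ((tendsto_one_div_atTop_nhds_zero_nat (𝕜 := ℝ)).const_mul (1 / 2))
    simpa [mul_comm] using this
  have := ge_of_tendsto hlim ((eventually_ge_atTop n).mono fun m hm =>
    hmono (Set.mem_Ici.2 hn) (Set.mem_Ici.2 (hn.trans hm)) hm)
  linarith

lemma le_harmonic_sub_log_sub_eulerMascheroniConstant {n : ℕ} (hn : 1 ≤ n) :
    1 / (2 * ((n : ℝ) + 1)) ≤ (harmonic n : ℝ) - Real.log n - Real.eulerMascheroniConstant := by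
  have hanti : AntitoneOn (fun n : ℕ => (harmonic n : ℝ) - Real.log n - 1 / (2 * ((n : ℝ) + 1)))
      (Set.Ici 1) := by
    refine antitoneOn_nat_Ici_of_succ_le fun m hm => ?_
    have hm0 : (0 : ℝ) < m := by exact_mod_cast hm
    have h := le_log_succ_sub_log hm
    have e : 1 / ((m : ℝ) + 1) + 1 / (2 * ((m : ℝ) + 1)) - 1 / (2 * ((m : ℝ) + 1 + 1))
        ≤ 2 / (2 * (m : ℝ) + 1) := by
      rw [show 1 / ((m : ℝ) + 1) + 1 / (2 * ((m : ℝ) + 1)) - 1 / (2 * ((m : ℝ) + 1 + 1))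
        = (2 * (m : ℝ) + 5) / (2 * ((m : ℝ) + 1) * ((m : ℝ) + 2)) by field_simp; ring,
        div_le_div_iff₀ (by positivity) (by positivity)]
      nlinarith
    rw [harmonic_succ_cast]
    push_cast
    linarith
  have hlim : Tendsto (fun n : ℕ => (harmonic n : ℝ) - Real.log n - 1 / (2 * ((n : ℝ) + 1)))
      atTop (𝓝 Real.eulerMascheroniConstant) := by
    have := Real.tendsto_harmonic_sub_log.sub
      ((tendsto_one_div_add_atTop_nhds_zero_nat (𝕜 := ℝ)).const_mul (1 / 2))
    simpa [mul_comm] using this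
  have := le_of_tendsto hlim ((eventually_ge_atTop n).mono fun m hm =>
    hanti (Set.mem_Ici.2 hn) (Set.mem_Ici.2 (hn.trans hm)) hm)
  linarith

lemma tendsto_mul_harmonic_sub_log_sub_eulerMascheroniConstant :
    Tendsto (fun n : ℕ =>
      (n : ℝ) * ((harmonic n : ℝ) - Real.log n - Real.eulerMascheroniConstant))
      atTop (𝓝 (1 / 2)) := by
  have hlow : Tendsto (fun n : ℕ => 1 / 2 - 1 / 2 * (1 / ((n : ℝ) + 1))) atTop (𝓝 (1 / 2)) := by
    have := ((tendsto_one_div_add_atTop_nhds_zero_nat (𝕜 := ℝ)).const_mul (1 / 2)).const_sub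
      (1 / 2)
    rwa [mul_zero, sub_zero] at this
  refine tendsto_of_tendsto_of_tendsto_of_le_of_le' hlow tendsto_const_nhds ?_ ?_
  · filter_upwards [eventually_ge_atTop 1] with n hn
    have hn0 : (0 : ℝ) < n := by exact_mod_cast hn
    refine le_of_eq_of_le ?_ (mul_le_mul_of_nonneg_left
      (le_harmonic_sub_log_sub_eulerMascheroniConstant hn) hn0.le)
    field_simp
    ring
  · filter_upwards [eventually_ge_atTop 1] with n hn
    have hn0 : (0 : ℝ) < n := by exact_mod_cast hn
    refine (mul_le_mul_of_nonneg_left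
      (harmonic_sub_log_sub_eulerMascheroniConstant_le hn) hn0.le).trans_eq ?_
    field_simp

/-! ### The alternating series and its partial sums -/

/-- The `n`-th term of the alternating series, without its sign. -/
noncomputable def harmonicLogTerm (x : ℝ) (n : ℕ) : ℝ :=
  (n : ℝ) * ((harmonic n : ℝ) - Real.log ((n : ℝ) + x - 1) - Real.eulerMascheroniConstant
    + x / (n : ℝ) - 3 / (2 * (n : ℝ)))

lemma tendsto_harmonicLogTerm {x : ℝ} (hx : 0 < x) :
    Tendsto (harmonicLogTerm x) atTop (𝓝 0) := by
  have h1 := tendsto_mul_harmonic_sub_log_sub_eulerMascheroniConstant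
  have h2 := (Real.tendsto_mul_log_one_add_div_atTop (x - 1)).comp
    (tendsto_natCast_atTop_atTop (R := ℝ))
  -- The constant `3/2` in the series is what makes these limits cancel.
  have h3 := (h1.sub h2).add_const (x - 3 / 2)
  rw [show (1 / 2 - (x - 1) + (x - 3 / 2) : ℝ) = 0 by ring] at h3
  refine h3.congr' ?_
  filter_upwards [eventually_ge_atTop 1] with n hn
  have hn1 : (1 : ℝ) ≤ n := by exact_mod_cast hn
  have hn0 : (0 : ℝ) < n := by linarith
  have hl : Real.log (1 + (x - 1) / n) = Real.log ((n : ℝ) + x - 1) - Real.log n := by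
    rw [← Real.log_div (by linarith) hn0.ne']
    congr 1
    field_simp
    ring
  simp only [Function.comp_apply, harmonicLogTerm, hl]
  field_simp
  ring

/-- Closed form of the partial sums of even length. -/
lemma sum_Icc_two_mul_harmonicLogTerm {x : ℝ} (hx : 0 < x) (M : ℕ) :
    ∑ n ∈ Icc 1 (2 * M), (-1 : ℝ) ^ n * harmonicLogTerm x n =
      ((M : ℝ) + 1 / 2) * (harmonic (2 * M) : ℝ) + (x / 2 - 1) * (harmonic M : ℝ)
      - (Real.eulerMascheroniConstant + 1 + Real.log 2) * M
      - 2 * (∑ k ∈ range M, barnesLogFactor ((x + 1) / 2 - 1) k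
        - ∑ k ∈ range M, barnesLogFactor (x / 2 - 1) k)
      - ∑ m ∈ range M, Real.log (x / 2 + m) := by
  induction M with
  | zero => simp
  | succ M ih =>
    have hM : (0 : ℝ) ≤ M := Nat.cast_nonneg M
    have hM1 : (0 : ℝ) < (M : ℝ) + 1 := by positivity
    have l1 : Real.log (2 * (M : ℝ) + 1 + x - 1) = Real.log 2 + Real.log (x / 2 + M) := by
      rw [← Real.log_mul two_ne_zero (by positivity)]
      congr 1
      ring
    have l2 : Real.log (x / 2 + M) =
        Real.log ((M : ℝ) + 1) + Real.log (1 + (x / 2 - 1) / ((M : ℝ) + 1)) := by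
      rw [← Real.log_mul hM1.ne' (one_add_div_natCast_succ_pos (by linarith) M).ne']
      congr 1
      field_simp
      ring
    have l3 : Real.log (2 * (M : ℝ) + 1 + 1 + x - 1) = Real.log 2 + Real.log ((M : ℝ) + 1)
        + Real.log (1 + ((x + 1) / 2 - 1) / ((M : ℝ) + 1)) := by
      rw [← Real.log_mul two_ne_zero hM1.ne', ← Real.log_mul (by positivity)
        (one_add_div_natCast_succ_pos (by linarith) M).ne']
      congr 1
      field_simp
      ring
    have s1 : (-1 : ℝ) ^ (2 * M + 1) = -1 := Odd.neg_one_pow ⟨M, rfl⟩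
    have s2 : (-1 : ℝ) ^ (2 * M + 1 + 1) = 1 := Even.neg_one_pow ⟨M + 1, by ring⟩
    rw [show 2 * (M + 1) = 2 * M + 1 + 1 by ring, sum_Icc_succ_top (by omega),
      sum_Icc_succ_top (by omega), ih, sum_range_succ, sum_range_succ, sum_range_succ,
      harmonicLogTerm, harmonicLogTerm, harmonic_succ_cast (2 * M + 1), harmonic_succ_cast (2 * M),
      harmonic_succ_cast M, barnesLogFactor, barnesLogFactor]
    push_cast
    rw [l1, l3, l2, s1, s2]
    generalize Real.log (1 + ((x + 1) / 2 - 1) / ((M : ℝ) + 1)) = a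
    generalize Real.log (1 + (x / 2 - 1) / ((M : ℝ) + 1)) = b
    field_simp
    ring

lemma tendsto_log_factorial_sub :
    Tendsto (fun n : ℕ => Real.log (n.factorial : ℝ)
        - ((n : ℝ) * Real.log n - n + Real.log n / 2))
      atTop (𝓝 (Real.log (2 * Real.pi) / 2)) := by
  have h := (Real.continuousAt_log (Real.sqrt_ne_zero'.2 Real.pi_pos)).tendsto.comp
    Stirling.tendsto_stirlingSeq_sqrt_pi
  rw [Real.log_sqrt Real.pi_pos.le] at h
  have h' := h.add_const (Real.log 2 / 2)
  rw [show Real.log Real.pi / 2 + Real.log 2 / 2 = Real.log (2 * Real.pi) / 2 by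
    rw [Real.log_mul two_ne_zero Real.pi_ne_zero]; ring] at h'
  refine h'.congr' ?_
  filter_upwards [eventually_ge_atTop 1] with n hn
  have hn0 : (n : ℝ) ≠ 0 := by exact_mod_cast (by omega : n ≠ 0)
  rw [Function.comp_apply, Stirling.log_stirlingSeq_formula, Real.log_mul two_ne_zero hn0,
    Real.log_div hn0 (Real.exp_ne_zero _), Real.log_exp]
  ring

lemma tendsto_sum_Icc_two_mul_harmonicLogTerm {x : ℝ} (hx : 0 < x) :
    Tendsto (fun M : ℕ => ∑ n ∈ Icc 1 (2 * M), (-1 : ℝ) ^ n * harmonicLogTerm x n) atTop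
      (𝓝 (Real.eulerMascheroniConstant / 4 - (x - Real.log 2 - 1) / 2
        - 2 * Real.log (barnesG ((x + 1) / 2) / barnesG (x / 2))
        + Real.log (Real.Gamma (x / 2)))) := by
  have htwo : Tendsto (fun M : ℕ => 2 * M) atTop atTop :=
    tendsto_id.const_mul_atTop' two_pos
  have hH := Real.tendsto_harmonic_sub_log
  have hH2 := hH.comp htwo
  have hMH := tendsto_mul_harmonic_sub_log_sub_eulerMascheroniConstant.comp htwo
  have hP1 := (summable_barnesLogFactor ((x + 1) / 2 - 1)).hasSum.tendsto_sum_nat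
  have hP2 := (summable_barnesLogFactor (x / 2 - 1)).hasSum.tendsto_sum_nat
  have hG := Real.BohrMollerup.tendsto_log_gamma (half_pos hx)
  have hS := tendsto_log_factorial_sub
  have hL := (Real.tendsto_log_comp_add_sub_log (x / 2)).comp
    (tendsto_natCast_atTop_atTop (R := ℝ))
  -- All divergent terms cancel here. `logGammaSeq` has one more factor than the partial sum, `x/2 +
  -- M`; `hL` matches its logarithm against `log M`.
  have key := (((((hMH.const_mul (1 / 2)).add (hH2.const_mul (1 / 2))).add
    (hH.const_mul (x / 2 - 1))).sub ((hP1.sub hP2).const_mul 2)).add hG).sub hS |>.add hL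
    |>.add_const (Real.log 2 / 2)
  have hlim : Real.eulerMascheroniConstant / 4 - (x - Real.log 2 - 1) / 2
        - 2 * Real.log (barnesG ((x + 1) / 2) / barnesG (x / 2))
        + Real.log (Real.Gamma (x / 2)) =
      1 / 2 * (1 / 2) + 1 / 2 * Real.eulerMascheroniConstant
        + (x / 2 - 1) * Real.eulerMascheroniConstant
        - 2 * (∑' k, barnesLogFactor ((x + 1) / 2 - 1) k - ∑' k, barnesLogFactor (x / 2 - 1) k)
        + Real.log (Real.Gamma (x / 2)) - Real.log (2 * Real.pi) / 2 + 0 + Real.log 2 / 2 := by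
    have h1 : 0 < (x + 1) / 2 := by linarith
    have h2 : 0 < x / 2 := by linarith
    rw [Real.log_div (barnesG_pos h1).ne' (barnesG_pos h2).ne', log_barnesG h1, log_barnesG h2]
    ring
  rw [hlim]
  refine key.congr' ?_
  filter_upwards [eventually_ge_atTop 1] with M hM
  have hM0 : (M : ℝ) ≠ 0 := by exact_mod_cast (by omega : M ≠ 0)
  rw [sum_Icc_two_mul_harmonicLogTerm hx]
  simp only [Function.comp_apply, Real.BohrMollerup.logGammaSeq, sum_range_succ]
  push_cast
  rw [Real.log_mul two_ne_zero hM0, add_comm (M : ℝ) (x / 2)]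
  ring

lemma tendsto_atTop_of_tendsto_two_mul_of_tendsto_two_mul_add_one {α : Type*} {u : ℕ → α}
    {l : Filter α} (heven : Tendsto (fun n => u (2 * n)) atTop l)
    (hodd : Tendsto (fun n => u (2 * n + 1)) atTop l) : Tendsto u atTop l := by
  intro s hs
  obtain ⟨a, ha⟩ := eventually_atTop.1 (heven hs)
  obtain ⟨b, hb⟩ := eventually_atTop.1 (hodd hs)
  refine eventually_atTop.2 ⟨2 * max a b + 1, fun n hn => ?_⟩
  obtain ⟨k, rfl | rfl⟩ := n.even_or_odd'
  · exact ha k (by omega)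
  · exact hb k (by omega)

theorem mainTheorem5 (x : ℝ) (hx : 0 < x) :
    Filter.Tendsto
      (fun N : ℕ => ∑ n ∈ Finset.Icc 1 N,
        (-1 : ℝ) ^ n * (n : ℝ) *
          ((harmonic n : ℝ) - Real.log ((n : ℝ) + x - 1) - Real.eulerMascheroniConstant
            + x / (n : ℝ) - 3 / (2 * (n : ℝ))))
      Filter.atTop
      (nhds (Real.eulerMascheroniConstant / 4 - (x - Real.log 2 - 1) / 2
        - 2 * Real.log (barnesG ((x + 1) / 2) / barnesG (x / 2))
        + Real.log (Real.Gamma (x / 2)))) := by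
  simp only [mul_assoc (_ ^ _ : ℝ)]
  change Tendsto (fun N : ℕ => ∑ n ∈ Icc 1 N, (-1 : ℝ) ^ n * harmonicLogTerm x n) atTop _
  have heven := tendsto_sum_Icc_two_mul_harmonicLogTerm hx
  refine tendsto_atTop_of_tendsto_two_mul_of_tendsto_two_mul_add_one heven ?_
  have hidx : Tendsto (fun M : ℕ => 2 * M + 1) atTop atTop :=
    tendsto_atTop_mono (fun M => by simp only [id]; omega) tendsto_id
  -- An odd partial sum is an even one minus a vanishing term.
  have h := heven.sub ((tendsto_harmonicLogTerm hx).comp hidx)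
  rw [sub_zero] at h
  refine h.congr fun M => ?_
  rw [sum_Icc_succ_top (by omega), Function.comp_apply, pow_succ, pow_mul]
  norm_num
  ring
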